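/- **The 2-category $\mathcal U$.** Let $\mathcal U^*$ be the $\mathbb Z$-linear graded strict 2-category with one object $n$ for each $n\in\mathbb Z$, whose 1-morphisms are the finite formal direct sums of shifts $w\mathbf 1_n\{s\}$ ($s\in\mathbb Z$) of words $w$ in $\mathcal E\colon n\to n+2$ and $\mathcal F\colon n\to n-2$ (composed from right to left), and whose 2-morphisms are generated, under vertical and horizontal composition and $\mathbb Z$-linear combination, by dots $z\colon\mathcal E\Rightarrow\mathcal E$, $\hat z\colon\mathcal F\Rightarrow\mathcal F$ of degree $2$; crossings $U\colon\mathcal{EE}\Rightarrow\mathcal{EE}$, $\hat U\colon\mathcal{FF}\Rightarrow\mathcal{FF}$ of degree $-2$; and cups and caps $\eta_n\colon\mathbf 1_n\Rightarrow\mathcal{FE}\mathbf 1_n$, $\hat\eta_n\colon\mathcal{FE}\mathbf 1_n\Rightarrow\mathbf 1_n$ of degree $n+1$, $\hat\varepsilon_n\colon\mathbf 1_n\Rightarrow\mathcal{EF}\mathbf 1_n$, $\varepsilon_n\colon\mathcal{EF}\mathbf 1_n\Rightarrow\mathbf 1_n$ of degree $1-n$. Together with the tautological isomorphisms $x\simeq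 x\{s\}$ of degree $s$, they are subject to the following relations, for all $n$. In them $gf$ denotes vertical composition ($f$ first), juxtaposition of a letter with a 2-morphism denotes horizontal composition with an identity, and $$\sigma=(\mathcal{FE}\varepsilon)(\mathcal FU\mathcal F)(\eta\,\mathcal{EF})\colon\mathcal{EF}\Rightarrow\mathcal{FE},\qquad \lambda=(\hat\eta\,\mathcal{EF})(\mathcal FU\mathcal F)(\mathcal{FE}\hat\varepsilon)\colon\mathcal{FE}\Rightarrow\mathcal{EF}$$ are the sideways crossings, and for $m\ge 0$ the dotted bubbles in a region labelled $n$ are $$c_m=\varepsilon_n(z^m\mathcal F)\hat\varepsilon_n\ \text{(clockwise)},\qquad \bar c_m=\hat\eta_n(\mathcal Fz^m)\eta_n\ \text{(counterclockwise)}.$$ 1. *Biadjointness*: $(\varepsilon\mathcal E)(\mathcal E\eta)=1_{\mathcal E}=(\mathcal E\hat\eta)(\hat\varepsilon\mathcal E)$ and $(\mathcal F\varepsilon)(\eta\mathcal F)=1_{\mathcal F}=(\hat\eta\mathcal F)(\mathcal F\hat\varepsilon)$. 2. *Cyclicity*: the left and the right dual of $z$ under these adjunctions both equal $\hat z$, and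 those of $U$ both equal $\hat U$. 3. *Bubbles*: $c_m=0$ if $m<n-1$, $\bar c_m=0$ if $m<-n-1$; bubbles of degree zero are identities: $c_{n-1}=1$ if $n\ge1$, $\bar c_{-n-1}=1$ if $n\le-1$. 4. *NilHecke*: $U^2=0$; $1_{\mathcal{EE}}=U(z\mathcal E)-(\mathcal Ez)U=(z\mathcal E)U-U(\mathcal Ez)$; $(U\mathcal E)(\mathcal EU)(U\mathcal E)=(\mathcal EU)(U\mathcal E)(\mathcal EU)$. 5. *Fake bubbles*: for $n\ge0$ put $\bar c_{-n-1}:=1$ and, for $1\le j\le n$, $\bar c_{-n-1+j}:=-\sum_{\ell=1}^{j}c_{n-1+\ell}\,\bar c_{-n-1+j-\ell}$; for $n\le0$ put $c_{n-1}:=1$ and, for $1\le j\le-n$, $c_{n-1+j}:=-\sum_{\ell=0}^{j-1}c_{n-1+\ell}\,\bar c_{-n-1+j-\ell}$. 6. *Reduction to bubbles* (empty sums are $0$): with $n$ the rightmost region, $(\mathcal E\varepsilon)(U\mathcal F)(\mathcal E\hat\varepsilon)=-\sum_{\ell=0}^{-n}z^{-n-\ell}\cdot c_{n-1+\ell}$,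 bubbles on the right of the strand; with $n$ the leftmost region, $(\hat\eta\mathcal E)(\mathcal FU)(\eta\mathcal E)=\sum_{j=0}^{n}\bar c_{-n-1+j}\cdot z^{n-j}$, bubbles on the left of the strand. 7. *Identity decomposition*: $$1_{\mathcal{EF}\mathbf 1_n}=-\lambda\sigma+\sum_{\ell=0}^{n-1}\sum_{j=0}^{\ell}(z^{n-1-\ell}\mathcal F)\hat\varepsilon_n\,\bar c_{-n-1+j}\,\varepsilon_n(z^{\ell-j}\mathcal F),$$ $$1_{\mathcal{FE}\mathbf 1_n}=-\sigma\lambda+\sum_{\ell=0}^{-n-1}\sum_{j=0}^{\ell}(\mathcal Fz^{-n-1-\ell})\eta_n\,c_{n-1+j}\,\hat\eta_n(\mathcal Fz^{\ell-j}).$$ $\mathcal U$ has the same objects and 1-morphisms, and only the degree-preserving 2-morphisms: those $x\{s\}\Rightarrow y\{t\}$ are the elements of $\mathcal U^*(x,y)$ of degree $s-t$. For an integer $a\ge 0$ write $\oplus_{[a]}x=x\{a-1\}\oplus x\{a-3\}\oplus\cdots\oplus x\{1-a\}$ (zero for $a=0$) and $[a]=q^{a-1}+q^{a-3}+\cdots+q^{1-a}$.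 **Theorem.** Let $n\in\mathbb Z$. (a) If $n\ge0$, put $\sigma_n=-\sigma$, $\lambda_n=\lambda$ and, for $0\le s\le n-1$, $$\sigma_s=\sum_{j=0}^s\bar c_{-n-1+j}\,\varepsilon_n(z^{s-j}\mathcal F)\colon\mathcal{EF}\mathbf 1_n\Rightarrow\mathbf 1_n\{n-1-2s\},\qquad\lambda_s=(z^{n-1-s}\mathcal F)\hat\varepsilon_n\colon\mathbf 1_n\{n-1-2s\}\Rightarrow\mathcal{EF}\mathbf 1_n .$$ Then the $e_s=\lambda_s\sigma_s$, $0\le s\le n$, are orthogonal idempotents in $\mathcal U(\mathcal{EF}\mathbf 1_n,\mathcal{EF}\mathbf 1_n)$ with sum $1$, and $\sigma_n,\sigma_0,\dots,\sigma_{n-1}$ are the components of an isomorphism in $\mathcal U$ $$\mathcal{EF}\mathbf 1_n\;\cong\;\mathcal{FE}\mathbf 1_n\oplus\bigl(\oplus_{[n]}\mathbf 1_n\bigr)$$ whose inverse has components $\lambda_n,\lambda_0,\dots,\lambda_{n-1}$. (b) If $n\le0$, put $\sigma_{-n}=-\lambda$, $\lambda_{-n}=\sigma$ and, for $0\le s\le-n-1$,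 $$\sigma_s=\sum_{j=0}^s c_{n-1+j}\,\hat\eta_n(\mathcal Fz^{s-j})\colon\mathcal{FE}\mathbf 1_n\Rightarrow\mathbf 1_n\{-n-1-2s\},\qquad\lambda_s=(\mathcal Fz^{-n-1-s})\eta_n\colon\mathbf 1_n\{-n-1-2s\}\Rightarrow\mathcal{FE}\mathbf 1_n .$$ Then the $\bar e_s=\lambda_s\sigma_s$, $0\le s\le-n$, are orthogonal idempotents in $\mathcal U(\mathcal{FE}\mathbf 1_n,\mathcal{FE}\mathbf 1_n)$ with sum $1$, and the $\sigma_s$ are the components of an isomorphism in $\mathcal U$ $$\mathcal{FE}\mathbf 1_n\;\cong\;\mathcal{EF}\mathbf 1_n\oplus\bigl(\oplus_{[-n]}\mathbf 1_n\bigr)$$ whose inverse has components $\lambda_s$. (c) Consequently these decompositions lift the $\mathfrak{sl}_2$ commutation relation: in the split Grothendieck group of the category $\mathcal U(n,n)$, a $\mathbb Z[q,q^{-1}]$-module via $q^s[x]=[x\{s\}]$, $$[\mathcal{EF}\mathbf 1_n]-[\mathcal{FE}\mathbf 1_n]=[n]\,[\mathbf 1_n]\ (n\ge0),\qquad[\mathcal{FE}\mathbf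 1_n]-[\mathcal{EF}\mathbf 1_n]=[-n]\,[\mathbf 1_n]\ (n\le0).$$ -/

import Mathlib

open CategoryTheory CategoryTheory.Limits
open scoped LaurentPolynomial

namespace CatSl2

/-! ## Words and diagrams -/

/-- The two generating letters: `E` raises the weight by `2`, `F` lowers it by `2`. -/
inductive Sgn where
  | E : Sgn
  | F : Sgn

open Sgn

/-- A composite of letters, written as in `E F 1_n`: the rightmost letter is applied first. -/
abbrev Word := List Sgn

def Sgn.wt : Sgn → ℤ
  | E => 2
  | F => -2

/-- Total weight: a word `w` is a 1-morphism from `n` to `n + wt w`. -/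
def wt : Word → ℤ
  | [] => 0
  | a :: w => a.wt + wt w

theorem wt_append (u v : Word) : wt (u ++ v) = wt u + wt v := by
  induction u with
  | nil => simp [wt]
  | cons a u ih => simp [wt, ih, add_assoc]

/-- The generating 2-morphisms: dots `z`, `ẑ`, nilCoxeter generators `U`, `Û`, and cups and caps.
`cupFE` is `η : 1 ⇒ F E`, `cupEF` is `ε̂ : 1 ⇒ E F`, `capFE` is `η̂ : F E ⇒ 1`,
`capEF` is `ε : E F ⇒ 1`. -/
inductive Gen where
  | dotE | dotF | crossE | crossF | cupFE | cupEF | capFE | capEF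

namespace Gen

def src : Gen → Word
  | dotE => [E]
  | dotF => [F]
  | crossE => [E, E]
  | crossF => [F, F]
  | cupFE => []
  | cupEF => []
  | capFE => [F, E]
  | capEF => [E, F]

def tgt : Gen → Word
  | dotE => [E]
  | dotF => [F]
  | crossE => [E, E]
  | crossF => [F, F]
  | cupFE => [F, E]
  | cupEF => [E, F]
  | capFE => []
  | capEF => []

/-- Degree of a generator whose rightmost region is labelled `k`. -/
def deg : Gen → ℤ → ℤ
  | dotE, _ => 2
  | dotF, _ => 2
  | crossE, _ => -2
  | crossF, _ => -2
  | cupFE, k => k + 1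
  | cupEF, k => 1 - k
  | capFE, k => k + 1
  | capEF, k => 1 - k

end Gen

/-- Formal `ℤ`-linear combinations of vertical composites of layers. The layer `gen u g v` is the
generator `g` with identity strands `u` on its left and `v` on its right. Diagrams are read from
bottom (source) to top (target), and `comp f g` puts `g` on top of `f`. -/
inductive Tm : Word → Word → Type where
  | gen (u : Word) (g : Gen) (v : Word) {x y : Word}
      (hx : x = u ++ (g.src ++ v)) (hy : y = u ++ (g.tgt ++ v)) : Tm x y
  | id (x : Word) : Tm x x
  | comp {x y z : Word} (f : Tm x y) (g : Tm y z) : Tm x z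
  | zero (x y : Word) : Tm x y
  | add {x y : Word} (f g : Tm x y) : Tm x y
  | neg {x y : Word} (f : Tm x y) : Tm x y

namespace Tm

/-- Add identity strands `w` on the left of a diagram. -/
def whL (w : Word) : {x y : Word} → Tm x y → Tm (w ++ x) (w ++ y)
  | _, _, gen u g v hx hy => gen (w ++ u) g v (by simp [hx]) (by simp [hy])
  | _, _, id x => id (w ++ x)
  | _, _, comp f g => comp (whL w f) (whL w g)
  | _, _, zero x y => zero (w ++ x) (w ++ y)
  | _, _, add f g => add (whL w f) (whL w g)
  | _, _, neg f => neg (whL w f)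

/-- Add identity strands `w` on the right of a diagram. -/
def whR (w : Word) : {x y : Word} → Tm x y → Tm (x ++ w) (y ++ w)
  | _, _, gen u g v hx hy => gen u g (v ++ w) (by simp [hx]) (by simp [hy])
  | _, _, id x => id (x ++ w)
  | _, _, comp f g => comp (whR w f) (whR w g)
  | _, _, zero x y => zero (x ++ w) (y ++ w)
  | _, _, add f g => add (whR w f) (whR w g)
  | _, _, neg f => neg (whR w f)

/-- A generator without additional strands. -/
def ofGen (g : Gen) : Tm g.src g.tgt := gen [] g [] (by simp) (by simp)

def dotE : Tm [E] [E] := ofGen Gen.dotE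
def dotF : Tm [F] [F] := ofGen Gen.dotF
def crossE : Tm [E, E] [E, E] := ofGen Gen.crossE
def crossF : Tm [F, F] [F, F] := ofGen Gen.crossF
def cupFE : Tm [] [F, E] := ofGen Gen.cupFE
def cupEF : Tm [] [E, F] := ofGen Gen.cupEF
def capFE : Tm [F, E] [] := ofGen Gen.capFE
def capEF : Tm [E, F] [] := ofGen Gen.capEF

/-- Finite sums. -/
def sum {x y : Word} : (k : ℕ) → (Fin k → Tm x y) → Tm x y
  | 0, _ => zero x y
  | k + 1, f => add (sum k fun i => f i.castSucc) (f (Fin.last k))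

/-- `m` dots on an upward strand. -/
def dots : ℕ → Tm [E] [E]
  | 0 => id [E]
  | m + 1 => comp (dots m) dotE

/- In the next four definitions the dots sit on the upward strand; by the duality relations for the
dots this is the same as putting them on the downward strand. -/

/-- The cup `1 ⇒ E F` with `m` dots. -/
def cupEFdots (m : ℕ) : Tm [] [E, F] := comp cupEF (whR [F] (dots m))
/-- The cap `E F ⇒ 1` with `m` dots. -/
def capEFdots (m : ℕ) : Tm [E, F] [] := comp (whR [F] (dots m)) capEF
/-- The cup `1 ⇒ F E` with `m` dots. -/
def cupFEdots (m : ℕ) : Tm [] [F, E] := comp cupFE (whL [F] (dots m))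
/-- The cap `F E ⇒ 1` with `m` dots. -/
def capFEdots (m : ℕ) : Tm [F, E] [] := comp (whL [F] (dots m)) capFE

/-- The clockwise bubble with `m` dots. -/
def cw (m : ℕ) : Tm [] [] := comp (cupEFdots m) capEF
/-- The counterclockwise bubble with `m` dots. -/
def ccw (m : ℕ) : Tm [] [] := comp (cupFEdots m) capFE

/-- The counterclockwise fake bubble with label `-n - 1 + j` in a region labelled `n`.
Meaningful, and used below, only for `0 ≤ j ≤ n`. -/
def fakeCCW (n : ℤ) : ℕ → Tm [] []
  | 0 => id []
  | j + 1 => neg (sum (j + 1) fun i => comp (cw (n + (i : ℕ)).toNat) (fakeCCW n (j - (i : ℕ))))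
termination_by j => j
decreasing_by omega

/-- The clockwise fake bubble with label `n - 1 + j` in a region labelled `n`.
Meaningful, and used below, only for `0 ≤ j ≤ -n`. -/
def fakeCW (n : ℤ) : ℕ → Tm [] []
  | 0 => id []
  | j + 1 => neg (sum (j + 1) fun i => comp (ccw (-n + (i : ℕ)).toNat) (fakeCW n (j - (i : ℕ))))
termination_by j => j
decreasing_by omega

/-- The sideways crossing `E F ⇒ F E`, obtained by rotating `U`. -/
def swapEF : Tm [E, F] [F, E] :=
  comp (y := [F, E, E, F]) (whR [E, F] cupFE)
    (comp (y := [F, E, E, F]) (whL [F] (whR [F] crossE)) (whL [F, E] capEF))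

/-- The sideways crossing `F E ⇒ E F`, obtained by rotating `U`. -/
def swapFE : Tm [F, E] [E, F] :=
  comp (y := [F, E, E, F]) (whL [F, E] cupEF)
    (comp (y := [F, E, E, F]) (whL [F] (whR [F] crossE)) (whR [E, F] capFE))

/-- The projection `σ_s : E F 1_n ⇒ 1_n`, for `n ≥ 0` and `0 ≤ s ≤ n - 1`: the sum over
`0 ≤ j ≤ s` of a cap with `s - j` dots below the fake bubble labelled `-n - 1 + j`. -/
def sigmaEF (n : ℤ) (s : ℕ) : Tm [E, F] [] :=
  sum (s + 1) fun j => comp (capEFdots (s - (j : ℕ))) (fakeCCW n j)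

/-- The inclusion `λ_s : 1_n ⇒ E F 1_n`, for `n ≥ 0`: a cup with `n - 1 - s` dots. -/
def lambdaEF (n : ℤ) (s : ℕ) : Tm [] [E, F] := cupEFdots (n.toNat - 1 - s)

/-- The projection `σ_s : F E 1_n ⇒ 1_n`, for `n ≤ 0` and `0 ≤ s ≤ -n - 1`. -/
def sigmaFE (n : ℤ) (s : ℕ) : Tm [F, E] [] :=
  sum (s + 1) fun j => comp (capFEdots (s - (j : ℕ))) (fakeCW n j)

/-- The inclusion `λ_s : 1_n ⇒ F E 1_n`, for `n ≤ 0`: a cup with `-n - 1 - s` dots. -/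
def lambdaFE (n : ℤ) (s : ℕ) : Tm [] [F, E] := cupFEdots ((-n).toNat - 1 - s)

end Tm

open Tm

/-! ## The relations -/

/-- Equality of 2-morphisms of `U^*`, for diagrams whose rightmost region is labelled `n`. -/
inductive Rel : ℤ → {x y : Word} → Tm x y → Tm x y → Prop where
  -- congruence
  | refl {n : ℤ} {x y : Word} (f : Tm x y) : Rel n f f
  | symm {n : ℤ} {x y : Word} {f g : Tm x y} : Rel n f g → Rel n g f
  | trans {n : ℤ} {x y : Word} {f g h : Tm x y} : Rel n f g → Rel n g h → Rel n f h
  | comp {n : ℤ} {x y z : Word} {f f' : Tm x y} {g g' : Tm y z} :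
      Rel n f f' → Rel n g g' → Rel n (comp f g) (comp f' g')
  | add {n : ℤ} {x y : Word} {f f' g g' : Tm x y} :
      Rel n f f' → Rel n g g' → Rel n (add f g) (add f' g')
  | neg {n : ℤ} {x y : Word} {f f' : Tm x y} : Rel n f f' → Rel n (neg f) (neg f')
  | whL {n : ℤ} {x y : Word} {f f' : Tm x y} (w : Word) : Rel n f f' → Rel n (whL w f) (whL w f')
  | whR {n : ℤ} {x y : Word} {f f' : Tm x y} (w : Word) :
      Rel (n + wt w) f f' → Rel n (whR w f) (whR w f')
  -- `ℤ`-linear strict 2-category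
  | id_comp {n : ℤ} {x y : Word} (f : Tm x y) : Rel n (Tm.comp (id x) f) f
  | comp_id {n : ℤ} {x y : Word} (f : Tm x y) : Rel n (Tm.comp f (id y)) f
  | assoc {n : ℤ} {w x y z : Word} (f : Tm w x) (g : Tm x y) (h : Tm y z) :
      Rel n (Tm.comp (Tm.comp f g) h) (Tm.comp f (Tm.comp g h))
  | add_assoc {n : ℤ} {x y : Word} (f g h : Tm x y) :
      Rel n (Tm.add (Tm.add f g) h) (Tm.add f (Tm.add g h))
  | add_comm {n : ℤ} {x y : Word} (f g : Tm x y) : Rel n (Tm.add f g) (Tm.add g f)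
  | zero_add {n : ℤ} {x y : Word} (f : Tm x y) : Rel n (Tm.add (zero x y) f) f
  | neg_add {n : ℤ} {x y : Word} (f : Tm x y) : Rel n (Tm.add (Tm.neg f) f) (zero x y)
  | add_comp {n : ℤ} {x y z : Word} (f g : Tm x y) (h : Tm y z) :
      Rel n (Tm.comp (Tm.add f g) h) (Tm.add (Tm.comp f h) (Tm.comp g h))
  | comp_add {n : ℤ} {x y z : Word} (f : Tm x y) (g h : Tm y z) :
      Rel n (Tm.comp f (Tm.add g h)) (Tm.add (Tm.comp f g) (Tm.comp f h))
  | exchange {n : ℤ} {x y x' y' : Word} (f : Tm x y) (g : Tm x' y') :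
      Rel n (Tm.comp (Tm.whL x g) (Tm.whR y' f)) (Tm.comp (Tm.whR x' f) (Tm.whL y g))
  -- biadjointness
  | zigzag₁ {n : ℤ} : Rel n
      (Tm.comp (y := [E, F, E]) (Tm.whL [E] cupFE) (Tm.whR [E] capEF)) (id [E])
  | zigzag₂ {n : ℤ} : Rel n
      (Tm.comp (y := [F, E, F]) (Tm.whR [F] cupFE) (Tm.whL [F] capEF)) (id [F])
  | zigzag₃ {n : ℤ} : Rel n
      (Tm.comp (y := [F, E, F]) (Tm.whL [F] cupEF) (Tm.whR [F] capFE)) (id [F])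
  | zigzag₄ {n : ℤ} : Rel n
      (Tm.comp (y := [E, F, E]) (Tm.whR [E] cupEF) (Tm.whL [E] capFE)) (id [E])
  -- both duals of `z` are `ẑ`
  | dual_dot₁ {n : ℤ} : Rel n
      (Tm.comp (y := [F, E, F]) (Tm.whL [F] cupEF)
        (Tm.comp (y := [F, E, F]) (Tm.whL [F] (Tm.whR [F] dotE)) (Tm.whR [F] capFE))) dotF
  | dual_dot₂ {n : ℤ} : Rel n
      (Tm.comp (y := [F, E, F]) (Tm.whR [F] cupFE)
        (Tm.comp (y := [F, E, F]) (Tm.whL [F] (Tm.whR [F] dotE)) (Tm.whL [F] capEF))) dotF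
  -- both duals of `U` are `Û`
  | dual_cross₁ {n : ℤ} : Rel n
      (Tm.comp (y := [F, F, E, F]) (Tm.whL [F, F] cupEF)
        (Tm.comp (y := [F, F, E, E, F, F]) (Tm.whL [F, F, E] (Tm.whR [F] cupEF))
          (Tm.comp (y := [F, F, E, E, F, F]) (Tm.whL [F, F] (Tm.whR [F, F] crossE))
            (Tm.comp (y := [F, E, F, F]) (Tm.whL [F] (Tm.whR [E, F, F] capFE))
              (Tm.whR [F, F] capFE))))) crossF
  | dual_cross₂ {n : ℤ} : Rel n
      (Tm.comp (y := [F, E, F, F]) (Tm.whR [F, F] cupFE)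
        (Tm.comp (y := [F, F, E, E, F, F]) (Tm.whL [F] (Tm.whR [E, F, F] cupFE))
          (Tm.comp (y := [F, F, E, E, F, F]) (Tm.whL [F, F] (Tm.whR [F, F] crossE))
            (Tm.comp (y := [F, F, E, F]) (Tm.whL [F, F, E] (Tm.whR [F] capEF))
              (Tm.whL [F, F] capEF))))) crossF
  -- bubbles of negative degree are zero, bubbles of degree zero are identities
  | cw_neg {n : ℤ} (m : ℕ) (h : (m : ℤ) < n - 1) : Rel n (cw m) (zero [] [])
  | ccw_neg {n : ℤ} (m : ℕ) (h : (m : ℤ) < -n - 1) : Rel n (ccw m) (zero [] [])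
  | cw_one {n : ℤ} (m : ℕ) (h : (m : ℤ) = n - 1) : Rel n (cw m) (id [])
  | ccw_one {n : ℤ} (m : ℕ) (h : (m : ℤ) = -n - 1) : Rel n (ccw m) (id [])
  -- nilHecke relations
  | nil_sq {n : ℤ} : Rel n (Tm.comp crossE crossE) (zero [E, E] [E, E])
  | nil_dot₁ {n : ℤ} : Rel n (id [E, E])
      (Tm.add (Tm.comp (y := [E, E]) (Tm.whR [E] dotE) crossE)
        (Tm.neg (Tm.comp (y := [E, E]) crossE (Tm.whL [E] dotE))))
  | nil_dot₂ {n : ℤ} : Rel n (id [E, E])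
      (Tm.add (Tm.comp (y := [E, E]) crossE (Tm.whR [E] dotE))
        (Tm.neg (Tm.comp (y := [E, E]) (Tm.whL [E] dotE) crossE)))
  | nil_braid {n : ℤ} : Rel n
      (Tm.comp (y := [E, E, E]) (Tm.whR [E] crossE)
        (Tm.comp (y := [E, E, E]) (Tm.whL [E] crossE) (Tm.whR [E] crossE)))
      (Tm.comp (y := [E, E, E]) (Tm.whL [E] crossE)
        (Tm.comp (y := [E, E, E]) (Tm.whR [E] crossE) (Tm.whL [E] crossE)))
  -- reduction to bubbles; in the second relation the leftmost region is labelled `n + 2`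
  | curl_right {n : ℤ} : Rel n
      (Tm.comp (y := [E, E, F]) (Tm.whL [E] cupEF)
        (Tm.comp (y := [E, E, F]) (Tm.whR [F] crossE) (Tm.whL [E] capEF)))
      (Tm.neg (Tm.sum (-n + 1).toNat fun l =>
        Tm.comp (y := [E]) (dots ((-n).toNat - (l : ℕ))) (Tm.whL [E] (fakeCW n l))))
  | curl_left {n : ℤ} : Rel n
      (Tm.comp (y := [F, E, E]) (Tm.whR [E] cupFE)
        (Tm.comp (y := [F, E, E]) (Tm.whL [F] crossE) (Tm.whR [E] capFE)))
      (Tm.sum (n + 2 + 1).toNat fun j =>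
        Tm.comp (y := [E]) (dots ((n + 2).toNat - (j : ℕ))) (Tm.whR [E] (fakeCCW (n + 2) j)))
  -- identity decomposition
  | decomp_EF {n : ℤ} : Rel n (id [E, F])
      (Tm.add (Tm.neg (Tm.comp swapEF swapFE))
        (Tm.sum n.toNat fun l => Tm.sum ((l : ℕ) + 1) fun j =>
          Tm.comp (capEFdots ((l : ℕ) - (j : ℕ)))
            (Tm.comp (fakeCCW n j) (cupEFdots (n.toNat - 1 - (l : ℕ))))))
  | decomp_FE {n : ℤ} : Rel n (id [F, E])
      (Tm.add (Tm.neg (Tm.comp swapFE swapEF))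
        (Tm.sum (-n).toNat fun l => Tm.sum ((l : ℕ) + 1) fun j =>
          Tm.comp (capFEdots ((l : ℕ) - (j : ℕ)))
            (Tm.comp (fakeCW n j) (cupFEdots ((-n).toNat - 1 - (l : ℕ))))))

/-- The abelian group of 2-morphisms `x 1_n ⇒ y 1_n` of `U^*` (of arbitrary degree). -/
def UStar (n : ℤ) (x y : Word) : Type := Quot (fun f g : Tm x y => Rel n f g)

namespace UStar

variable {n : ℤ} {x y z : Word}

def mk (n : ℤ) {x y : Word} (f : Tm x y) : UStar n x y := Quot.mk _ f

theorem sound {f g : Tm x y} (h : Rel n f g) : mk n f = mk n g := Quot.sound h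

instance : Zero (UStar n x y) := ⟨mk n (Tm.zero x y)⟩
instance : Add (UStar n x y) :=
  ⟨Quot.map₂ Tm.add (fun _ _ _ h => Rel.add (Rel.refl _) h) (fun _ _ _ h => Rel.add h (Rel.refl _))⟩
instance : Neg (UStar n x y) := ⟨Quot.map Tm.neg fun _ _ h => Rel.neg h⟩

instance : AddCommGroup (UStar n x y) :=
  { AddGroup.ofLeftAxioms (G := UStar n x y)
      (by rintro ⟨a⟩ ⟨b⟩ ⟨c⟩; exact sound (Rel.add_assoc a b c))
      (by rintro ⟨a⟩; exact sound (Rel.zero_add a))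
      (by rintro ⟨a⟩; exact sound (Rel.neg_add a)) with
    add_comm := by rintro ⟨a⟩ ⟨b⟩; exact sound (Rel.add_comm a b) }

/-- Vertical composition. -/
def comp : UStar n x y → UStar n y z → UStar n x z :=
  Quot.map₂ Tm.comp (fun _ _ _ h => Rel.comp (Rel.refl _) h) (fun _ _ _ h => Rel.comp h (Rel.refl _))

/-- Adding strands on the left. -/
def whL (w : Word) : UStar n x y → UStar n (w ++ x) (w ++ y) :=
  Quot.map (Tm.whL w) fun _ _ h => Rel.whL w h

/-- Adding strands on the right. -/
def whR {m : ℤ} (w : Word) (h : m = n + wt w) : UStar m x y → UStar n (x ++ w) (y ++ w) :=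
  Quot.map (Tm.whR w) fun _ _ r => Rel.whR w (h ▸ r)

end UStar

/-! ## The grading -/

/-- `Tm.IsHomog n d f`: every diagram in `f` has degree `d` when the rightmost region is
labelled `n`. -/
def Tm.IsHomog (n : ℤ) : ℤ → {x y : Word} → Tm x y → Prop
  | d, _, _, Tm.gen _ g v _ _ => g.deg (n + wt v) = d
  | d, _, _, Tm.id _ => d = 0
  | d, _, _, Tm.comp f g => ∃ a b, a + b = d ∧ Tm.IsHomog n a f ∧ Tm.IsHomog n b g
  | _, _, _, Tm.zero _ _ => True
  | d, _, _, Tm.add f g => Tm.IsHomog n d f ∧ Tm.IsHomog n d g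
  | d, _, _, Tm.neg f => Tm.IsHomog n d f

/-- The homogeneous 2-morphisms of degree `d`. -/
def UStar.homog (n d : ℤ) (x y : Word) : AddSubgroup (UStar n x y) where
  carrier := {q | ∃ f : Tm x y, f.IsHomog n d ∧ UStar.mk n f = q}
  zero_mem' := ⟨Tm.zero x y, trivial, rfl⟩
  add_mem' := by
    rintro _ _ ⟨f, hf, rfl⟩ ⟨g, hg, rfl⟩
    exact ⟨Tm.add f g, ⟨hf, hg⟩, rfl⟩
  neg_mem' := by
    rintro _ ⟨f, hf, rfl⟩
    exact ⟨Tm.neg f, hf, rfl⟩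

namespace Tm

theorem IsHomog.whL {n d : ℤ} (w : Word) {x y : Word} {f : Tm x y} (hf : f.IsHomog n d) :
    (f.whL w).IsHomog n d := by
  induction f generalizing d with
  | gen u g v hx hy => exact hf
  | id x => exact hf
  | comp f g ihf ihg =>
    obtain ⟨a, b, h, ha, hb⟩ := hf
    exact ⟨a, b, h, ihf ha, ihg hb⟩
  | zero x y => trivial
  | add f g ihf ihg => exact ⟨ihf hf.1, ihg hf.2⟩
  | neg f ih => exact ih hf

theorem IsHomog.whR {n d : ℤ} (w : Word) {x y : Word} {f : Tm x y}
    (hf : f.IsHomog (n + wt w) d) : (f.whR w).IsHomog n d := by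
  induction f generalizing d with
  | gen u g v hx hy =>
    simp only [Tm.whR, Tm.IsHomog, wt_append] at hf ⊢
    rw [← hf]; congr 1; ring
  | id x => exact hf
  | comp f g ihf ihg =>
    obtain ⟨a, b, h, ha, hb⟩ := hf
    exact ⟨a, b, h, ihf ha, ihg hb⟩
  | zero x y => trivial
  | add f g ihf ihg => exact ⟨ihf hf.1, ihg hf.2⟩
  | neg f ih => exact ih hf

/-- Transport of a diagram along equalities of source and target. -/
def cast {x y x' y' : Word} (hx : x = x') (hy : y = y') (f : Tm x y) : Tm x' y' :=
  hx ▸ hy ▸ f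

/-- The identity 2-morphism between equal words. -/
def ofEq {x y : Word} (h : x = y) : Tm x y := cast rfl h (id x)

theorem ofEq_homog (n : ℤ) {x y : Word} (h : x = y) : (ofEq h).IsHomog n 0 := by
  subst h; exact rfl

theorem cast_rel (n : ℤ) {x y x' y' : Word} (hx : x = x') (hy : y = y') (f : Tm x y) :
    Rel n (cast hx hy f) (comp (ofEq hx.symm) (comp f (ofEq hy))) := by
  subst hx hy
  exact ((Rel.id_comp _).trans (Rel.comp_id _)).symm

theorem cast_gen {x y x' y' u v : Word} {g : Gen} (hx : x = x') (hy : y = y')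
    (h₁ : x = u ++ (g.src ++ v)) (h₂ : y = u ++ (g.tgt ++ v)) :
    cast hx hy (gen u g v h₁ h₂) = gen u g v (hx ▸ h₁) (hy ▸ h₂) := by
  subst hx hy; rfl

theorem gen_congr {x y u u' v v' : Word} {g : Gen} (hu : u = u') (hv : v = v')
    (h₁ : x = u ++ (g.src ++ v)) (h₂ : y = u ++ (g.tgt ++ v)) :
    gen u g v h₁ h₂ = gen u' g v' (hu ▸ hv ▸ h₁) (hu ▸ hv ▸ h₂) := by
  subst hu hv; rfl

theorem cast_id {x x' : Word} (h : x = x') : cast h h (id x) = id x' := by subst h; rfl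

theorem cast_comp {x y z x' y' z' : Word} (hx : x = x') (hy : y = y') (hz : z = z')
    (f : Tm x y) (g : Tm y z) :
    cast hx hz (comp f g) = comp (cast hx hy f) (cast hy hz g) := by
  subst hx hy hz; rfl

theorem cast_zero {x y x' y' : Word} (hx : x = x') (hy : y = y') :
    cast hx hy (zero x y) = zero x' y' := by subst hx hy; rfl

theorem cast_add {x y x' y' : Word} (hx : x = x') (hy : y = y') (f g : Tm x y) :
    cast hx hy (add f g) = add (cast hx hy f) (cast hx hy g) := by subst hx hy; rfl

theorem cast_neg {x y x' y' : Word} (hx : x = x') (hy : y = y') (f : Tm x y) :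
    cast hx hy (neg f) = neg (cast hx hy f) := by subst hx hy; rfl

theorem whR_nil {x y : Word} (f : Tm x y) :
    whR [] f = cast (List.append_nil x).symm (List.append_nil y).symm f := by
  induction f with
  | gen u g v hx hy => rw [cast_gen]; exact gen_congr rfl (List.append_nil v) _ _
  | id x => rw [cast_id]; rfl
  | comp f g ihf ihg => rw [cast_comp _ (List.append_nil _).symm, ← ihf, ← ihg]; rfl
  | zero x y => rw [cast_zero]; rfl
  | add f g ihf ihg => rw [cast_add, ← ihf, ← ihg]; rfl
  | neg f ih => rw [cast_neg, ← ih]; rfl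

theorem whL_nil {x y : Word} (f : Tm x y) : whL [] f = f := by
  induction f with
  | gen u g v hx hy => rfl
  | id x => rfl
  | comp f g ihf ihg => exact congrArg₂ Tm.comp ihf ihg
  | zero x y => rfl
  | add f g ihf ihg => exact congrArg₂ Tm.add ihf ihg
  | neg f ih => exact congrArg Tm.neg ih

theorem whR_append (v w : Word) {x y : Word} (f : Tm x y) :
    whR (v ++ w) f =
      cast (List.append_assoc x v w) (List.append_assoc y v w) (whR w (whR v f)) := by
  induction f with
  | gen u g t hx hy =>
    simp only [whR]; rw [cast_gen]; exact gen_congr rfl (List.append_assoc t v w).symm _ _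
  | id x => simp only [whR]; rw [cast_id]
  | comp f g ihf ihg => simp only [whR]; rw [cast_comp _ (List.append_assoc _ v w), ← ihf, ← ihg]
  | zero x y => simp only [whR]; rw [cast_zero]
  | add f g ihf ihg => simp only [whR]; rw [cast_add, ← ihf, ← ihg]
  | neg f ih => simp only [whR]; rw [cast_neg, ← ih]

theorem whL_append (v w : Word) {x y : Word} (f : Tm x y) :
    whL (v ++ w) f =
      cast (List.append_assoc v w x).symm (List.append_assoc v w y).symm (whL v (whL w f)) := by
  induction f with
  | gen u g t hx hy =>
    simp only [whL]; rw [cast_gen]; exact gen_congr (List.append_assoc v w u) rfl _ _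
  | id x => simp only [whL]; rw [cast_id]
  | comp f g ihf ihg =>
    simp only [whL]; rw [cast_comp _ (List.append_assoc v w _).symm, ← ihf, ← ihg]
  | zero x y => simp only [whL]; rw [cast_zero]
  | add f g ihf ihg => simp only [whL]; rw [cast_add, ← ihf, ← ihg]
  | neg f ih => simp only [whL]; rw [cast_neg, ← ih]

theorem whL_whR (v w : Word) {x y : Word} (f : Tm x y) :
    whL v (whR w f) =
      cast (List.append_assoc v x w) (List.append_assoc v y w) (whR w (whL v f)) := by
  induction f with
  | gen u g t hx hy => simp only [whL, whR]; rw [cast_gen]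
  | id x => simp only [whL, whR]; rw [cast_id]
  | comp f g ihf ihg =>
    simp only [whL, whR]; rw [cast_comp _ (List.append_assoc v _ w), ← ihf, ← ihg]
  | zero x y => simp only [whL, whR]; rw [cast_zero]
  | add f g ihf ihg => simp only [whL, whR]; rw [cast_add, ← ihf, ← ihg]
  | neg f ih => simp only [whL, whR]; rw [cast_neg, ← ih]

theorem whL_ofEq (w : Word) {x y : Word} (h : x = y) :
    whL w (ofEq h) = ofEq (congrArg (w ++ ·) h) := by subst h; rfl

theorem whR_ofEq (w : Word) {x y : Word} (h : x = y) :
    whR w (ofEq h) = ofEq (congrArg (· ++ w) h) := by subst h; rfl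

theorem ofEq_comp (n : ℤ) {x y z : Word} (h : x = y) (h' : y = z) :
    Rel n (comp (ofEq h) (ofEq h')) (ofEq (h.trans h')) := by
  subst h h'; exact Rel.id_comp _

end Tm

/-! ## The 2-category -/

/-- Objects: one for each integer weight. -/
structure Wt where
  n : ℤ

/-- A 1-morphism `w 1_n {s}` given by a single word: a composite `w` of letters starting at the
weight of `a` and ending at the weight of `b`, with a grading shift. -/
structure OneMor (a b : Wt) where
  word : Word
  shift : ℤ
  wt_eq : b.n = a.n + wt word

namespace OneMor

variable {a b c : Wt}

/-- The 2-morphisms `x ⇒ y` of `U` are the degree-preserving ones: a 2-morphism of degree `d`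
between the unshifted words has degree `d + t - s` as a 2-morphism `x{s} ⇒ y{t}`. -/
instance : Category (OneMor a b) where
  Hom x y := UStar.homog a.n (x.shift - y.shift) x.word y.word
  id x := ⟨UStar.mk a.n (Tm.id x.word), Tm.id x.word, sub_self _, rfl⟩
  comp {x y z} f g := ⟨UStar.comp f.1 g.1, by
    obtain ⟨_, f, hf, rfl⟩ := f
    obtain ⟨_, g, hg, rfl⟩ := g
    exact ⟨Tm.comp f g, ⟨_, _, by ring, hf, hg⟩, rfl⟩⟩
  id_comp := by
    rintro x y ⟨_, f, hf, rfl⟩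
    exact Subtype.ext (UStar.sound (Rel.id_comp f))
  comp_id := by
    rintro x y ⟨_, f, hf, rfl⟩
    exact Subtype.ext (UStar.sound (Rel.comp_id f))
  assoc := by
    rintro w x y z ⟨_, f, hf, rfl⟩ ⟨_, g, hg, rfl⟩ ⟨_, h, hh, rfl⟩
    exact Subtype.ext (UStar.sound (Rel.assoc f g h))

/-- The 2-morphism of `U` given by a homogeneous diagram. -/
def ofTm (x y : OneMor a b) (f : Tm x.word y.word) (hf : f.IsHomog a.n (x.shift - y.shift)) :
    x ⟶ y := ⟨UStar.mk a.n f, f, hf, rfl⟩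

theorem ofTm_eq {x y : OneMor a b} {f g : Tm x.word y.word}
    {hf : f.IsHomog a.n (x.shift - y.shift)} {hg : g.IsHomog a.n (x.shift - y.shift)}
    (h : Rel a.n f g) : ofTm x y f hf = ofTm x y g hg :=
  Subtype.ext (UStar.sound h)

instance (x y : OneMor a b) : AddCommGroup (x ⟶ y) :=
  inferInstanceAs (AddCommGroup (UStar.homog a.n (x.shift - y.shift) x.word y.word))

instance : Preadditive (OneMor a b) where
  add_comp := by
    rintro x y z ⟨_, f, hf, rfl⟩ ⟨_, g, hg, rfl⟩ ⟨_, h, hh, rfl⟩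
    exact Subtype.ext (UStar.sound (Rel.add_comp f g h))
  comp_add := by
    rintro x y z ⟨_, f, hf, rfl⟩ ⟨_, g, hg, rfl⟩ ⟨_, h, hh, rfl⟩
    exact Subtype.ext (UStar.sound (Rel.comp_add f g h))

/-- The canonical isomorphism between 1-morphisms with equal words and shifts. -/
def isoOfEq (x y : OneMor a b) (h : x.word = y.word) (hs : x.shift = y.shift) : x ≅ y where
  hom := ofTm x y (Tm.ofEq h) (by rw [hs, sub_self]; exact Tm.ofEq_homog _ h)
  inv := ofTm y x (Tm.ofEq h.symm) (by rw [hs, sub_self]; exact Tm.ofEq_homog _ h.symm)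
  hom_inv_id := Subtype.ext (UStar.sound (Tm.ofEq_comp _ h h.symm))
  inv_hom_id := Subtype.ext (UStar.sound (Tm.ofEq_comp _ h.symm h))

end OneMor

open OneMor

/-- The 2-category `U`, before formal direct sums of 1-morphisms are added: horizontal composition
is juxtaposition. It is strict; associators and unitors are identities of equal words. -/
instance : Bicategory Wt where
  Hom := OneMor
  id a := ⟨[], 0, by simp [wt]⟩
  comp f g := ⟨g.word ++ f.word, f.shift + g.shift, by
    rw [g.wt_eq, f.wt_eq, wt_append]; ring⟩
  homCategory _ _ := inferInstance
  whiskerLeft {a b c} f {g h} η := ⟨UStar.whR f.word f.wt_eq η.1, by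
    obtain ⟨_, t, ht, rfl⟩ := η
    refine ⟨t.whR f.word, ?_, rfl⟩
    rw [add_sub_add_left_eq_sub]
    exact Tm.IsHomog.whR f.word (f.wt_eq ▸ ht)⟩
  whiskerRight {a b c} {f g} η h := ⟨UStar.whL h.word η.1, by
    obtain ⟨_, t, ht, rfl⟩ := η
    refine ⟨t.whL h.word, ?_, rfl⟩
    rw [add_sub_add_right_eq_sub]
    exact Tm.IsHomog.whL h.word ht⟩
  associator f g h := isoOfEq _ _ (List.append_assoc h.word g.word f.word).symm (add_assoc _ _ _)
  leftUnitor f := isoOfEq _ _ (List.append_nil f.word) (zero_add _)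
  rightUnitor f := isoOfEq _ _ (List.nil_append f.word) (add_zero _)
  whiskerLeft_id f g := rfl
  whiskerLeft_comp := by
    rintro a b c f g h i ⟨_, s, hs, rfl⟩ ⟨_, t, ht, rfl⟩; rfl
  id_whiskerLeft := by
    rintro a b f g ⟨_, t, ht, rfl⟩
    refine Subtype.ext (UStar.sound ?_)
    rw [Tm.whR_nil]
    exact Tm.cast_rel _ _ _ t
  comp_whiskerLeft := by
    rintro a b c d f g h h' ⟨_, t, ht, rfl⟩
    refine Subtype.ext (UStar.sound ?_)
    rw [Tm.whR_append]
    exact Tm.cast_rel _ _ _ _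
  id_whiskerRight f g := rfl
  comp_whiskerRight := by
    rintro a b c f g h ⟨_, s, hs, rfl⟩ ⟨_, t, ht, rfl⟩ i; rfl
  whiskerRight_id := by
    rintro a b f g ⟨_, t, ht, rfl⟩
    refine Subtype.ext (UStar.sound ?_)
    rw [Tm.whL_nil]
    exact Tm.cast_rel _ rfl rfl t
  whiskerRight_comp := by
    rintro a b c d f f' ⟨_, t, ht, rfl⟩ g h
    refine Subtype.ext (UStar.sound ?_)
    rw [Tm.whL_append]
    exact Tm.cast_rel _ _ _ _
  whisker_assoc := by
    rintro a b c d f g g' ⟨_, t, ht, rfl⟩ h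
    refine Subtype.ext (UStar.sound ?_)
    rw [Tm.whL_whR]
    exact Tm.cast_rel _ _ _ _
  whisker_exchange := by
    rintro a b c f g h i ⟨_, s, hs, rfl⟩ ⟨_, t, ht, rfl⟩
    refine Subtype.ext (UStar.sound ?_)
    exact (Rel.exchange t s).symm
  pentagon f g h i := by
    refine Subtype.ext (UStar.sound ?_)
    change Rel _ (Tm.comp
      (Tm.whL i.word (Tm.ofEq (List.append_assoc h.word g.word f.word).symm))
      (Tm.comp (Tm.ofEq (List.append_assoc i.word (h.word ++ g.word) f.word).symm)
        (Tm.whR f.word (Tm.ofEq (List.append_assoc i.word h.word g.word).symm))))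
      (Tm.comp (Tm.ofEq (List.append_assoc i.word h.word (g.word ++ f.word)).symm)
        (Tm.ofEq (List.append_assoc (i.word ++ h.word) g.word f.word).symm))
    rw [Tm.whL_ofEq, Tm.whR_ofEq]
    exact ((Rel.comp (Rel.refl _) (Tm.ofEq_comp _ _ _)).trans (Tm.ofEq_comp _ _ _)).trans
      (Tm.ofEq_comp _ _ _).symm
  triangle f g := by
    refine Subtype.ext (UStar.sound ?_)
    change Rel _ (Tm.comp
      (Tm.ofEq (List.append_assoc g.word [] f.word).symm)
      (Tm.whR f.word (Tm.ofEq (List.append_nil g.word))))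
      (Tm.whL g.word (Tm.ofEq (List.nil_append f.word)))
    rw [Tm.whL_ofEq, Tm.whR_ofEq]
    exact Tm.ofEq_comp _ _ _

instance (a b : Wt) : Preadditive (a ⟶ b) := inferInstanceAs (Preadditive (OneMor a b))

/-- The shift `x{s}`. -/
def OneMor.sh {a b : Wt} (x : a ⟶ b) (s : ℤ) : a ⟶ b := ⟨x.word, x.shift + s, x.wt_eq⟩

/-- The generating 1-morphism `E : n → n + 2`. -/
def Emor (a b : Wt) (h : b.n = a.n + 2) : a ⟶ b := ⟨[E], 0, by simp [wt, Sgn.wt, h]⟩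

/-- The generating 1-morphism `F : n → n - 2`. -/
def Fmor (a b : Wt) (h : b.n = a.n - 2) : a ⟶ b := ⟨[F], 0, by simp [wt, Sgn.wt, h]; ring⟩

/-- `E F 1_n`; composition `≫` is in diagrammatic order, so `F` is applied first. -/
def EF (n : ℤ) : (⟨n⟩ : Wt) ⟶ ⟨n⟩ :=
  Fmor ⟨n⟩ ⟨n - 2⟩ rfl ≫ Emor ⟨n - 2⟩ ⟨n⟩ (by simp)

/-- `F E 1_n`. -/
def FE (n : ℤ) : (⟨n⟩ : Wt) ⟶ ⟨n⟩ :=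
  Emor ⟨n⟩ ⟨n + 2⟩ rfl ≫ Fmor ⟨n + 2⟩ ⟨n⟩ (by simp)

/-- `1_n{s}`. -/
def oneSh (n s : ℤ) : (⟨n⟩ : Wt) ⟶ ⟨n⟩ := OneMor.sh (𝟙 (⟨n⟩ : Wt)) s

/-! ## Degrees of the diagrams in the decompositions -/

namespace Tm

theorem IsHomog.congr {n d d' : ℤ} {x y : Word} {f : Tm x y} (hf : f.IsHomog n d)
    (h : d = d') : f.IsHomog n d' := h ▸ hf

theorem IsHomog.comp' {n a b : ℤ} {x y z : Word} {f : Tm x y} {g : Tm y z}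
    (hf : f.IsHomog n a) (hg : g.IsHomog n b) : (Tm.comp f g).IsHomog n (a + b) :=
  ⟨a, b, rfl, hf, hg⟩

theorem ofGen_homog (g : Gen) (n : ℤ) : (ofGen g).IsHomog n (g.deg n) := by
  simp [ofGen, IsHomog, wt]

theorem sum_homog {n d : ℤ} {x y : Word} (k : ℕ) (f : Fin k → Tm x y)
    (h : ∀ i, (f i).IsHomog n d) : (sum k f).IsHomog n d := by
  induction k with
  | zero => trivial
  | succ k ih => exact ⟨ih _ fun i => h _, h _⟩

theorem dots_homog (n : ℤ) (m : ℕ) : (dots m).IsHomog n (2 * m) := by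
  induction m with
  | zero => simp [dots, IsHomog]
  | succ m ih => exact (ih.comp' (ofGen_homog Gen.dotE n)).congr (by simp [Gen.deg]; ring)

theorem cupEFdots_homog (n : ℤ) (m : ℕ) : (cupEFdots m).IsHomog n (1 - n + 2 * m) :=
  (ofGen_homog Gen.cupEF n).comp' (IsHomog.whR [F] (dots_homog _ m))

theorem capEFdots_homog (n : ℤ) (m : ℕ) : (capEFdots m).IsHomog n (1 - n + 2 * m) :=
  ((IsHomog.whR [F] (dots_homog _ m)).comp' (ofGen_homog Gen.capEF n)).congr (add_comm _ _)

theorem cupFEdots_homog (n : ℤ) (m : ℕ) : (cupFEdots m).IsHomog n (n + 1 + 2 * m) :=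
  (ofGen_homog Gen.cupFE n).comp' (IsHomog.whL [F] (dots_homog _ m))

theorem capFEdots_homog (n : ℤ) (m : ℕ) : (capFEdots m).IsHomog n (n + 1 + 2 * m) :=
  ((IsHomog.whL [F] (dots_homog _ m)).comp' (ofGen_homog Gen.capFE n)).congr (add_comm _ _)

theorem cw_homog (n : ℤ) (m : ℕ) : (cw m).IsHomog n (2 * (m - n + 1)) :=
  ((cupEFdots_homog n m).comp' (ofGen_homog Gen.capEF n)).congr (by simp [Gen.deg]; ring)

theorem ccw_homog (n : ℤ) (m : ℕ) : (ccw m).IsHomog n (2 * (m + n + 1)) :=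
  ((cupFEdots_homog n m).comp' (ofGen_homog Gen.capFE n)).congr (by simp [Gen.deg]; ring)

theorem fakeCCW_homog {n : ℤ} (hn : 0 ≤ n) (j : ℕ) : (fakeCCW n j).IsHomog n (2 * j) := by
  induction j using Nat.strong_induction_on with
  | _ j ih =>
    cases j with
    | zero => rw [fakeCCW]; simp [IsHomog]
    | succ j =>
      rw [fakeCCW]
      refine sum_homog (d := 2 * ((j + 1 : ℕ) : ℤ)) _ _ fun i => ?_
      refine ((cw_homog n _).comp' (ih (j - i) (by omega))).congr ?_
      have := i.isLt
      omega

theorem fakeCW_homog {n : ℤ} (hn : n ≤ 0) (j : ℕ) : (fakeCW n j).IsHomog n (2 * j) := by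
  induction j using Nat.strong_induction_on with
  | _ j ih =>
    cases j with
    | zero => rw [fakeCW]; simp [IsHomog]
    | succ j =>
      rw [fakeCW]
      refine sum_homog (d := 2 * ((j + 1 : ℕ) : ℤ)) _ _ fun i => ?_
      refine ((ccw_homog n _).comp' (ih (j - i) (by omega))).congr ?_
      have := i.isLt
      omega

theorem swapEF_homog (n : ℤ) : swapEF.IsHomog n 0 := by
  have h₁ := IsHomog.whR (n := n) [E, F] (ofGen_homog Gen.cupFE _)
  have h₂ := IsHomog.whL [F] (IsHomog.whR (n := n) [F] (ofGen_homog Gen.crossE _))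
  have h₃ := IsHomog.whL [F, E] (ofGen_homog Gen.capEF n)
  exact (IsHomog.comp' (y := [F, E, E, F]) h₁
    (IsHomog.comp' (y := [F, E, E, F]) h₂ h₃)).congr
    (by simp [Gen.deg, wt, Sgn.wt]; ring)

theorem swapFE_homog (n : ℤ) : swapFE.IsHomog n 0 := by
  have h₁ := IsHomog.whL [F, E] (ofGen_homog Gen.cupEF n)
  have h₂ := IsHomog.whL [F] (IsHomog.whR (n := n) [F] (ofGen_homog Gen.crossE _))
  have h₃ := IsHomog.whR (n := n) [E, F] (ofGen_homog Gen.capFE _)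
  exact (IsHomog.comp' (y := [F, E, E, F]) h₁
    (IsHomog.comp' (y := [F, E, E, F]) h₂ h₃)).congr
    (by simp [Gen.deg, wt, Sgn.wt]; ring)

end Tm

/-! ## The maps of the decompositions, as 2-morphisms of `U` -/

/-- `σ_n : E F 1_n ⇒ F E 1_n`, minus the sideways crossing. -/
def sigmaSwapEF (n : ℤ) : EF n ⟶ FE n :=
  OneMor.ofTm (EF n) (FE n) (Tm.neg swapEF) (swapEF_homog n)

/-- `λ_n : F E 1_n ⇒ E F 1_n`. -/
def lambdaSwapEF (n : ℤ) : FE n ⟶ EF n :=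
  OneMor.ofTm (FE n) (EF n) swapFE (swapFE_homog n)

/-- `σ_{-n} : F E 1_n ⇒ E F 1_n`, minus the sideways crossing. -/
def sigmaSwapFE (n : ℤ) : FE n ⟶ EF n :=
  OneMor.ofTm (FE n) (EF n) (Tm.neg swapFE) (swapFE_homog n)

/-- `λ_{-n} : E F 1_n ⇒ F E 1_n`. -/
def lambdaSwapFE (n : ℤ) : EF n ⟶ FE n :=
  OneMor.ofTm (EF n) (FE n) swapEF (swapEF_homog n)

/-- `σ_s : E F 1_n ⇒ 1_n{n - 1 - 2s}` for `0 ≤ s ≤ n - 1`. -/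
def sigEF (n : ℤ) (s : Fin n.toNat) : EF n ⟶ oneSh n ((n.toNat : ℤ) - 1 - 2 * (s : ℕ)) :=
  OneMor.ofTm (EF n) (oneSh n _) (sigmaEF n s) (by
    have hs := s.isLt
    refine sum_homog _ _ fun j => ?_
    refine ((capEFdots_homog n _).comp' (fakeCCW_homog (by omega) _)).congr ?_
    change _ = (0 + 0 : ℤ) - (0 + ((n.toNat : ℤ) - 1 - 2 * (s : ℕ)))
    have := j.isLt
    omega)

/-- `λ_s : 1_n{n - 1 - 2s} ⇒ E F 1_n` for `0 ≤ s ≤ n - 1`. -/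
def lamEF (n : ℤ) (s : Fin n.toNat) : oneSh n ((n.toNat : ℤ) - 1 - 2 * (s : ℕ)) ⟶ EF n :=
  OneMor.ofTm (oneSh n _) (EF n) (lambdaEF n s) (by
    have hs := s.isLt
    refine (cupEFdots_homog n _).congr ?_
    change _ = (0 + ((n.toNat : ℤ) - 1 - 2 * (s : ℕ))) - (0 + 0 : ℤ)
    omega)

/-- `σ_s : F E 1_n ⇒ 1_n{-n - 1 - 2s}` for `0 ≤ s ≤ -n - 1`. -/
def sigFE (n : ℤ) (s : Fin (-n).toNat) : FE n ⟶ oneSh n (((-n).toNat : ℤ) - 1 - 2 * (s : ℕ)) :=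
  OneMor.ofTm (FE n) (oneSh n _) (sigmaFE n s) (by
    have hs := s.isLt
    refine sum_homog _ _ fun j => ?_
    refine ((capFEdots_homog n _).comp' (fakeCW_homog (by omega) _)).congr ?_
    change _ = (0 + 0 : ℤ) - (0 + (((-n).toNat : ℤ) - 1 - 2 * (s : ℕ)))
    have := j.isLt
    omega)

/-- `λ_s : 1_n{-n - 1 - 2s} ⇒ F E 1_n` for `0 ≤ s ≤ -n - 1`. -/
def lamFE (n : ℤ) (s : Fin (-n).toNat) : oneSh n (((-n).toNat : ℤ) - 1 - 2 * (s : ℕ)) ⟶ FE n :=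
  OneMor.ofTm (oneSh n _) (FE n) (lambdaFE n s) (by
    have hs := s.isLt
    refine (cupFEdots_homog n _).congr ?_
    change _ = (0 + (((-n).toNat : ℤ) - 1 - 2 * (s : ℕ))) - (0 + 0 : ℤ)
    omega)

/-- The endomorphisms `e_s = λ_s σ_s` of `E F 1_n`; `none` is the one through `F E 1_n`. -/
def idemEF (n : ℤ) : Option (Fin n.toNat) → End (EF n)
  | none => sigmaSwapEF n ≫ lambdaSwapEF n
  | some s => sigEF n s ≫ lamEF n s

/-- The endomorphisms `λ_s σ_s` of `F E 1_n`; `none` is the one through `E F 1_n`. -/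
def idemFE (n : ℤ) : Option (Fin (-n).toNat) → End (FE n)
  | none => sigmaSwapFE n ≫ lambdaSwapFE n
  | some s => sigFE n s ≫ lamFE n s

/-! ## Formal direct sums -/

/-- The additive category `U(n, m)`: its objects are finite formal direct sums of shifted words and
its morphisms are matrices of 2-morphisms. -/
abbrev UCat (n m : ℤ) := Mat_ ((⟨n⟩ : Wt) ⟶ ⟨m⟩)

instance (n m : ℤ) : HasBinaryBiproducts (UCat n m) := hasBinaryBiproducts_of_finite_biproducts _

/-- A word, as a formal direct sum with one term. -/
abbrev inc (n m : ℤ) : ((⟨n⟩ : Wt) ⟶ ⟨m⟩) ⥤ UCat n m := Mat_.embedding _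

/-- The shift `X{s}` of a formal direct sum. -/
def UCat.sh {n m : ℤ} (X : UCat n m) (s : ℤ) : UCat n m :=
  { ι := X.ι, X := fun i => OneMor.sh (X.X i) s }

/-- `⊕_{[a]} X = X{a-1} ⊕ X{a-3} ⊕ ⋯ ⊕ X{1-a}`. -/
noncomputable def qSum {n m : ℤ} (a : ℕ) (X : UCat n m) : UCat n m :=
  ⨁ fun i : Fin a => X.sh ((a : ℤ) - 1 - 2 * (i : ℕ))

/-- The projection of `⊕_{[a]} X` onto its summand `X{a-1-2i}`. -/
noncomputable def qProj {n m : ℤ} (a : ℕ) (X : UCat n m) (i : Fin a) :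
    qSum a X ⟶ X.sh ((a : ℤ) - 1 - 2 * (i : ℕ)) :=
  biproduct.π (fun i : Fin a => X.sh ((a : ℤ) - 1 - 2 * (i : ℕ))) i

/-- The inclusion into `⊕_{[a]} X` of its summand `X{a-1-2i}`. -/
noncomputable def qIncl {n m : ℤ} (a : ℕ) (X : UCat n m) (i : Fin a) :
    X.sh ((a : ℤ) - 1 - 2 * (i : ℕ)) ⟶ qSum a X :=
  biproduct.ι (fun i : Fin a => X.sh ((a : ℤ) - 1 - 2 * (i : ℕ))) i

/-- `E F 1_n`, `F E 1_n` and `1_n` as objects of `U(n, n)`. -/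
abbrev objEF (n : ℤ) : UCat n n := (inc n n).obj (EF n)
abbrev objFE (n : ℤ) : UCat n n := (inc n n).obj (FE n)
abbrev objOne (n : ℤ) : UCat n n := (inc n n).obj (𝟙 (⟨n⟩ : Wt))

/-! ## The split Grothendieck group -/

/-- Relations of the split Grothendieck group of `U(n, m)`: isomorphic objects are identified,
`[X ⊕ Y] = [X] + [Y]`, and `[X{s}] = q^s [X]`. -/
inductive K0Rel (n m : ℤ) : (UCat n m →₀ ℤ[T;T⁻¹]) → Prop where
  | iso (X Y : UCat n m) (φ : X ≅ Y) :
      K0Rel n m (Finsupp.single X 1 - Finsupp.single Y 1)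
  | sum (X Y : UCat n m) :
      K0Rel n m (Finsupp.single (X ⊞ Y) 1 - Finsupp.single X 1 - Finsupp.single Y 1)
  | shift (X : UCat n m) (s : ℤ) :
      K0Rel n m (Finsupp.single (X.sh s) 1 - Finsupp.single X (LaurentPolynomial.T s))

/-- The split Grothendieck group of `U(n, m)`, as a `ℤ[q, q⁻¹]`-module. -/
abbrev K0 (n m : ℤ) := (UCat n m →₀ ℤ[T;T⁻¹]) ⧸ Submodule.span ℤ[T;T⁻¹] {r | K0Rel n m r}

/-- The class `[X]`. -/
noncomputable def K0.cls {n m : ℤ} (X : UCat n m) : K0 n m :=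
  Submodule.Quotient.mk (Finsupp.single X 1)

/-- The quantum integer `[a] = q^{a-1} + q^{a-3} + ⋯ + q^{1-a}`. -/
noncomputable def qInt (a : ℕ) : ℤ[T;T⁻¹] :=
  ∑ i : Fin a, LaurentPolynomial.T ((a : ℤ) - 1 - 2 * (i : ℕ))

end CatSl2

namespace CatSl2

open Tm

/-! The theorem reduces to a statement about an additive category: if maps σ out of an object X and
maps λ into it satisfy ∑ λσ = 1 and suitable orthonormality, then they exhibit X as a biproduct.
`SplitData` asks only for the part of orthonormality that must be computed, namely λ₀ followed by σ₀
is the identity of the large summand, and the pairings among the shifted units are Kronecker deltas.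
The mixed pairings then vanish automatically (`l_σ₀`, `l₀_σ`): sandwiching the completeness relation
between the two maps shows that the mixed pairing equals twice itself.

For n ≥ 0 the three inputs have different sources. Completeness is the identity decomposition of EF
with its double sum regrouped (`total_EF`). The identity on FE is the decomposition of FE, whose
bubble sum is empty when n ≥ 0 (`swapFE_neg_swapEF`). The pairings among units are closed diagrams:
λ_t followed by σ_s is the sum over j of the clockwise bubble with n-1+(s-t)-j dots times the j-th
fake bubble (`lambda_sigma_EF`). Because bubbles of negative degree vanish and the bubble of degree
zero is 1, this is the coefficient of degree s-t in the product of two power series, and the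
recursion defining fake bubbles says precisely that these series are mutually inverse
(`sum_inverse_series`). The case n ≤ 0 exchanges E with F and clockwise with counterclockwise
bubbles.

The additive embedding into formal direct sums carries such data to an isomorphism. Its class in the
split Grothendieck group is computed by additivity over finite biproducts (`cls_biproduct`) and the
shift relation. -/

/-! ## Isomorphisms onto biproducts from a complete system of components -/

section Preadditive

variable {C : Type*} [Category C] [Preadditive C] {X A : C} {k : ℕ} {D : Fin k → C}

/-- Maps `σ`, `λ` through objects `A`, `D s`, such that the composites `σ ≫ λ` add up to the
identity of `X` and such that the `D s` are orthonormal among themselves. -/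
structure SplitData (X A : C) {k : ℕ} (D : Fin k → C) where
  σ₀ : X ⟶ A
  l₀ : A ⟶ X
  σ : ∀ s, X ⟶ D s
  l : ∀ s, D s ⟶ X
  l₀_σ₀ : l₀ ≫ σ₀ = 𝟙 A
  l_σ : ∀ s, l s ≫ σ s = 𝟙 (D s)
  l_σ_ne : ∀ s t, s ≠ t → l s ≫ σ t = 0
  total : σ₀ ≫ l₀ + ∑ s, σ s ≫ l s = 𝟙 X

namespace SplitData

variable (S : SplitData X A D)

theorem sum_l_σ (t : Fin k) : S.l t ≫ ∑ s, S.σ s ≫ S.l s = S.l t := by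
  rw [Preadditive.comp_sum, Finset.sum_eq_single t]
  · rw [← Category.assoc, S.l_σ, Category.id_comp]
  · intro s _ hs
    rw [← Category.assoc, S.l_σ_ne t s (Ne.symm hs), zero_comp]
  · simp

theorem sum_σ_l (t : Fin k) : (∑ s, S.σ s ≫ S.l s) ≫ S.σ t = S.σ t := by
  rw [Preadditive.sum_comp, Finset.sum_eq_single t]
  · rw [Category.assoc, S.l_σ, Category.comp_id]
  · intro s _ hs
    rw [Category.assoc, S.l_σ_ne s t hs, comp_zero]
  · simp

/-- Compose `total` with `S.l t` on one side and `S.σ₀` on the other. Since `S.l₀ ≫ S.σ₀ = 𝟙 A`, the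
first term gives the pairing back, and by `sum_l_σ` so does the sum; thus p + p = p. No diagrammatic
computation of the mixed terms is needed. -/
theorem l_σ₀ (t : Fin k) : S.l t ≫ S.σ₀ = 0 := by
  have h := congrArg (fun f => S.l t ≫ f ≫ S.σ₀) S.total
  simp only [Preadditive.add_comp, Preadditive.comp_add, Category.assoc, S.l₀_σ₀,
    Category.comp_id, Category.id_comp] at h
  rw [← Category.assoc (S.l t) (∑ s, _), sum_l_σ] at h
  simpa using h

/-- The same cancellation from the other side, with `sum_σ_l` absorbing the sum. -/
theorem l₀_σ (t : Fin k) : S.l₀ ≫ S.σ t = 0 := by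
  have h := congrArg (fun f => S.l₀ ≫ f ≫ S.σ t) S.total
  simp only [Preadditive.add_comp, Preadditive.comp_add, sum_σ_l, Category.id_comp] at h
  rw [Category.assoc, ← Category.assoc S.l₀ S.σ₀, S.l₀_σ₀, Category.id_comp] at h
  simpa using h

/-- The endomorphisms of `X` through `A` and through the `D s`. -/
def idem : Option (Fin k) → End X
  | none => S.σ₀ ≫ S.l₀
  | some s => S.σ s ≫ S.l s

theorem completeOrthogonalIdempotents : CompleteOrthogonalIdempotents S.idem where
  idem := by
    rintro (_ | s)
    · change (S.σ₀ ≫ S.l₀) ≫ S.σ₀ ≫ S.l₀ = S.σ₀ ≫ S.l₀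
      rw [Category.assoc, ← Category.assoc S.l₀, S.l₀_σ₀, Category.id_comp]
    · change (S.σ s ≫ S.l s) ≫ S.σ s ≫ S.l s = S.σ s ≫ S.l s
      rw [Category.assoc, ← Category.assoc (S.l s), S.l_σ, Category.id_comp]
  ortho := by
    rintro (_ | s) (_ | t) h
    · exact absurd rfl h
    -- Multiplication in `End` is composition in the opposite order to `≫`, so the second index acts
    -- first.
    · change (S.σ t ≫ S.l t) ≫ S.σ₀ ≫ S.l₀ = 0
      rw [Category.assoc, ← Category.assoc (S.l t), l_σ₀, zero_comp, comp_zero]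
    · change (S.σ₀ ≫ S.l₀) ≫ S.σ s ≫ S.l s = 0
      rw [Category.assoc, ← Category.assoc S.l₀, l₀_σ, zero_comp, comp_zero]
    · change (S.σ t ≫ S.l t) ≫ S.σ s ≫ S.l s = 0
      rw [Category.assoc, ← Category.assoc (S.l t), S.l_σ_ne t s (by rintro rfl; exact h rfl),
        zero_comp, comp_zero]
  complete := by
    rw [Fintype.sum_option]
    exact S.total

/-- The image under an additive functor. -/
def map {C' : Type*} [Category C'] [Preadditive C'] (G : C ⥤ C') [G.Additive] :
    SplitData (G.obj X) (G.obj A) (fun s => G.obj (D s)) where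
  σ₀ := G.map S.σ₀
  l₀ := G.map S.l₀
  σ s := G.map (S.σ s)
  l s := G.map (S.l s)
  l₀_σ₀ := by rw [← G.map_comp, S.l₀_σ₀, G.map_id]
  l_σ s := by rw [← G.map_comp, S.l_σ, G.map_id]
  l_σ_ne s t h := by rw [← G.map_comp, S.l_σ_ne s t h, G.map_zero]
  total := by
    simp only [← G.map_comp]
    rw [← G.map_sum, ← G.map_add, S.total, G.map_id]

/-- The isomorphism with components `σ` whose inverse has components `λ`. -/
noncomputable def iso [HasBinaryBiproducts C] [HasFiniteBiproducts C] : X ≅ A ⊞ (⨁ D) where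
  hom := biprod.lift S.σ₀ (biproduct.lift S.σ)
  inv := biprod.desc S.l₀ (biproduct.desc S.l)
  hom_inv_id := by
    rw [biprod.lift_desc, biproduct.lift_desc, S.total]
  inv_hom_id := by
    -- The composite is checked as a matrix: two diagonal blocks from the orthonormality fields, two
    -- off-diagonal blocks from the vanishing of the mixed pairings.
    refine biprod.hom_ext' _ _ (biprod.hom_ext _ _ ?_ (biproduct.hom_ext _ _ fun t => ?_))
      (biproduct.hom_ext' _ _ fun s => biprod.hom_ext _ _ ?_ (biproduct.hom_ext _ _ fun t => ?_))
    · simp [S.l₀_σ₀]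
    · simp [S.l₀_σ]
    · simp [S.l_σ₀]
    · by_cases h : s = t
      · subst h; simp [S.l_σ]
      · simp [S.l_σ_ne s t h, biproduct.ι_π_ne _ h]

end SplitData

/-- A biproduct over `Fin (k + 1)` splits off its last summand. -/
noncomputable def biproductSuccIso [HasBinaryBiproducts C] [HasFiniteBiproducts C]
    (f : Fin (k + 1) → C) : (⨁ f) ≅ f (Fin.last k) ⊞ ⨁ fun i : Fin k => f i.castSucc :=
  SplitData.iso
    { σ₀ := biproduct.π f (Fin.last k)
      l₀ := biproduct.ι f (Fin.last k)
      σ := fun i => biproduct.π f i.castSucc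
      l := fun i => biproduct.ι f i.castSucc
      l₀_σ₀ := biproduct.ι_π_self f _
      l_σ := fun _ => biproduct.ι_π_self f _
      l_σ_ne := fun _ _ h => biproduct.ι_π_ne f fun h' => h (Fin.castSucc_injective _ h')
      total := by
        exact (add_comm _ _).trans <| (Fin.sum_univ_castSucc fun i => biproduct.π f i ≫ biproduct.ι f i).symm.trans
          biproduct.total }

end Preadditive

/-! ## Classes in the split Grothendieck group -/

namespace K0

variable {n m : ℤ}

theorem cls_iso {X Y : UCat n m} (φ : X ≅ Y) : cls X = cls Y :=
  (Submodule.Quotient.eq _).2 (Submodule.subset_span (K0Rel.iso X Y φ))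

theorem cls_biprod (X Y : UCat n m) : cls (X ⊞ Y) = cls X + cls Y := by
  refine (Submodule.Quotient.eq _).2 ?_
  rw [← sub_sub]
  exact Submodule.subset_span (K0Rel.sum X Y)

theorem cls_sh (X : UCat n m) (s : ℤ) :
    cls (X.sh s) = (LaurentPolynomial.T s : ℤ[T;T⁻¹]) • cls X := by
  have h := (Submodule.Quotient.eq (Submodule.span ℤ[T;T⁻¹] {r | K0Rel n m r})).2
    (Submodule.subset_span (K0Rel.shift X s))
  rw [cls, cls, ← Submodule.Quotient.mk_smul, h, Finsupp.smul_single, smul_eq_mul, mul_one]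

/-- The generating relations do not mention zero objects, but a zero object satisfies X ≅ X ⊞ X, so
its class equals its own double. -/
theorem cls_of_isZero {X : UCat n m} (h : IsZero X) : cls X = 0 := by
  have e : X ≅ X ⊞ X :=
    { hom := 0, inv := 0, hom_inv_id := h.eq_of_src _ _
      inv_hom_id := biprod.hom_ext _ _ (h.eq_of_tgt _ _) (h.eq_of_tgt _ _) }
  have h' := cls_iso e
  rw [cls_biprod] at h'
  simpa using h'

/-- The relations give additivity only for binary sums; splitting off the last summand with
`biproductSuccIso` extends it to finite ones, and the empty biproduct is a zero object. -/
theorem cls_biproduct (k : ℕ) (f : Fin k → UCat n m) : cls (⨁ f) = ∑ i, cls (f i) := by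
  induction k with
  | zero =>
    rw [Fin.sum_univ_zero]
    refine cls_of_isZero ((IsZero.iff_id_eq_zero _).2 ?_)
    exact biproduct.hom_ext _ _ fun i => i.elim0
  | succ k ih => rw [cls_iso (biproductSuccIso f), cls_biprod, ih, Fin.sum_univ_castSucc, add_comm]

theorem cls_qSum (a : ℕ) (X : UCat n m) : cls (qSum a X) = qInt a • cls X := by
  rw [qSum, cls_biproduct, qInt, Finset.sum_smul]
  exact Finset.sum_congr rfl fun i _ => cls_sh X _

theorem cls_sub_of_iso {X A Y : UCat n m} {a : ℕ} (φ : X ≅ A ⊞ qSum a Y) :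
    cls X - cls A = qInt a • cls Y := by
  rw [cls_iso φ, cls_biprod, cls_qSum, add_sub_cancel_left]

end K0

/-! ## Calculus of 2-morphisms -/

namespace UStar

variable {n : ℤ} {x y z w : Word}

/-- Vertical composition as a biadditive map. -/
def compHom : UStar n x y →+ UStar n y z →+ UStar n x z :=
  AddMonoidHom.mk' (fun f => AddMonoidHom.mk' (fun g => f.comp g) (by
      rintro ⟨g⟩ ⟨h⟩
      induction f using Quot.ind
      exact sound (Rel.comp_add _ g h)))
    (by
      rintro ⟨f⟩ ⟨g⟩
      refine AddMonoidHom.ext ?_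
      rintro ⟨h⟩
      exact sound (Rel.add_comp f g h))

theorem comp_assoc (f : UStar n w x) (g : UStar n x y) (h : UStar n y z) :
    (f.comp g).comp h = f.comp (g.comp h) := by
  induction f using Quot.ind
  induction g using Quot.ind
  induction h using Quot.ind
  exact sound (Rel.assoc _ _ _)

theorem sum_comp {ι : Type*} (s : Finset ι) (f : ι → UStar n x y) (g : UStar n y z) :
    (∑ i ∈ s, f i).comp g = ∑ i ∈ s, (f i).comp g := by
  change compHom (∑ i ∈ s, f i) g = _
  rw [map_sum, AddMonoidHom.finsetSum_apply]
  rfl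

theorem comp_sum {ι : Type*} (s : Finset ι) (f : UStar n x y) (g : ι → UStar n y z) :
    f.comp (∑ i ∈ s, g i) = ∑ i ∈ s, f.comp (g i) :=
  map_sum (compHom f) g s

theorem mk_sum (k : ℕ) (f : Fin k → Tm x y) : mk n (Tm.sum k f) = ∑ i, mk n (f i) := by
  induction k with
  | zero => rfl
  | succ k ih =>
    rw [Fin.sum_univ_castSucc, ← ih]
    rfl

end UStar

open UStar

/-! ### Pairings of dotted cups and caps: bubbles and fake bubbles -/

theorem dots_add (n : ℤ) (a b : ℕ) : Rel n (comp (dots a) (dots b)) (dots (a + b)) := by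
  induction b with
  | zero => exact Rel.comp_id _
  | succ b ih => exact (Rel.assoc _ _ _).symm.trans (ih.comp (Rel.refl _))

/-- Both arcs carry their dots on the upward strand, so stacking them merely concatenates dots; none
has to slide around an arc. -/
theorem cup_cap_EF (n : ℤ) (a b : ℕ) :
    (mk n (cupEFdots a)).comp (mk n (capEFdots b)) = mk n (cw (a + b)) := by
  refine sound ((Rel.assoc _ _ _).symm.trans (Rel.comp ?_ (Rel.refl _)))
  exact (Rel.assoc _ _ _).trans ((Rel.refl _).comp ((dots_add _ a b).whR [Sgn.F]))

theorem cup_cap_FE (n : ℤ) (a b : ℕ) :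
    (mk n (cupFEdots a)).comp (mk n (capFEdots b)) = mk n (ccw (a + b)) := by
  refine sound ((Rel.assoc _ _ _).symm.trans (Rel.comp ?_ (Rel.refl _)))
  exact (Rel.assoc _ _ _).trans ((Rel.refl _).comp ((dots_add _ a b).whL [Sgn.F]))

/-- Truncated inversion of power series: `c` starts with `1` in degree `N - 1`, and `b` is its
inverse. -/
theorem sum_inverse_series {M : Type*} [AddCommGroup M] {N : ℕ} (c : ℕ → M →+ M) (b : ℕ → M)
    (hlt : ∀ m, m + 1 < N → c m = 0) (hone : ∀ m, m + 1 = N → c m = AddMonoidHom.id M)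
    (hb : ∀ j, b (j + 1) = -∑ i : Fin (j + 1), c (N + i) (b (j - i)))
    {s t : ℕ} (ht : t < N) :
    ∑ j : Fin (s + 1), c (N - 1 - t + (s - j)) (b j) = if s = t then b 0 else 0 := by
  rw [Fin.sum_univ_eq_sum_range (fun j => c (N - 1 - t + (s - j)) (b j)) (s + 1)]
  rcases lt_or_ge s t with hst | hst
  · rw [if_neg hst.ne]
    -- For s < t every index is below N - 1, so every coefficient has negative degree.
    refine Finset.sum_eq_zero fun j hj => ?_
    rw [hlt _ (by omega), AddMonoidHom.zero_apply]
  obtain ⟨d, rfl⟩ := Nat.exists_eq_add_of_le hst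
  -- With s = t + d, the terms with j > d have index below N - 1 and drop out. What remains is the
  -- degree-d coefficient of the product of the two series.
  have hsub : ∑ j ∈ Finset.range (t + d + 1), c (N - 1 - t + (t + d - j)) (b j) =
      ∑ j ∈ Finset.range (d + 1), c (N - 1 + (d - j)) (b j) := by
    symm
    refine Finset.sum_subset_zero_on_sdiff (Finset.range_mono (by omega)) ?_ ?_
    · intro j hj
      simp only [Finset.mem_sdiff, Finset.mem_range] at hj
      rw [hlt _ (by omega), AddMonoidHom.zero_apply]
    · intro j hj
      rw [Finset.mem_range] at hj
      congr 2
      omega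
  rw [hsub]
  cases d with
  | zero => simp [hone (N - 1) (by omega)]
  | succ d =>
    -- The top term carries the leading coefficient 1, so it is b (d + 1). The recursion `hb` makes
    -- this minus the sum of the remaining terms, in reversed order.
    rw [if_neg (by omega), Finset.sum_range_succ, Nat.sub_self, add_zero,
      hone (N - 1) (by omega), AddMonoidHom.id_apply, hb,
      Fin.sum_univ_eq_sum_range (fun i => c (N + i) (b (d - i))) (d + 1),
      ← Finset.sum_range_reflect (fun i => c (N + i) (b (d - i))), add_neg_eq_zero]
    refine Finset.sum_congr rfl fun j hj => ?_
    rw [Finset.mem_range] at hj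
    rw [show N - 1 + (d + 1 - j) = N + (d + 1 - 1 - j) by omega,
      show d - (d + 1 - 1 - j) = j by omega]

theorem lambda_sigma_EF {n : ℤ} {s t : ℕ} (ht : t < n.toNat) :
    (mk n (lambdaEF n t)).comp (mk n (sigmaEF n s)) = if s = t then mk n (Tm.id []) else 0 := by
  have h₀ : fakeCCW n 0 = Tm.id [] := by rw [fakeCCW]
  -- The series c consists of the operators of composition with a clockwise bubble, acting on
  -- endomorphisms of the empty word. Only their additivity is needed, and the value b 0 is the
  -- identity by the definition of fake bubbles.
  rw [← h₀, ← sum_inverse_series (N := n.toNat) (fun m => compHom (mk n (cw m)))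
    (fun j => mk n (fakeCCW n j)) ?_ ?_ ?_ ht]
  · rw [sigmaEF, mk_sum, UStar.comp_sum]
    refine Finset.sum_congr rfl fun j _ => ?_
    change (mk n (lambdaEF n t)).comp ((mk n (capEFdots _)).comp (mk n (fakeCCW n j))) = _
    rw [← UStar.comp_assoc, lambdaEF, cup_cap_EF]
    rfl
  · intro m hm
    rw [sound (Rel.cw_neg (n := n) m (by omega))]
    exact map_zero compHom
  · intro m hm
    refine AddMonoidHom.ext ?_
    rintro ⟨f⟩
    exact (congrArg (fun g => UStar.comp g (mk n f)) (sound (Rel.cw_one (n := n) m (by omega)))).trans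
      (sound (Rel.id_comp f))
  · intro j
    rw [fakeCCW]
    change -(mk n (Tm.sum _ _)) = _
    rw [mk_sum]
    congr 1
    refine Finset.sum_congr rfl fun i _ => ?_
    -- Here n > 0 because `t < n.toNat`, so `toNat` in the definition of the fake bubble does not
    -- truncate.
    have : (n + ((i : ℕ) : ℤ)).toNat = n.toNat + i := by omega
    rw [this]
    rfl

theorem lambda_sigma_FE {n : ℤ} {s t : ℕ} (ht : t < (-n).toNat) :
    (mk n (lambdaFE n t)).comp (mk n (sigmaFE n s)) = if s = t then mk n (Tm.id []) else 0 := by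
  have h₀ : fakeCW n 0 = Tm.id [] := by rw [fakeCW]
  rw [← h₀, ← sum_inverse_series (N := (-n).toNat) (fun m => compHom (mk n (ccw m)))
    (fun j => mk n (fakeCW n j)) ?_ ?_ ?_ ht]
  · rw [sigmaFE, mk_sum, UStar.comp_sum]
    refine Finset.sum_congr rfl fun j _ => ?_
    change (mk n (lambdaFE n t)).comp ((mk n (capFEdots _)).comp (mk n (fakeCW n j))) = _
    rw [← UStar.comp_assoc, lambdaFE, cup_cap_FE]
    rfl
  · intro m hm
    rw [sound (Rel.ccw_neg (n := n) m (by omega))]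
    exact map_zero compHom
  · intro m hm
    refine AddMonoidHom.ext ?_
    rintro ⟨f⟩
    exact (congrArg (fun g => UStar.comp g (mk n f)) (sound (Rel.ccw_one (n := n) m (by omega)))).trans
      (sound (Rel.id_comp f))
  · intro j
    rw [fakeCW]
    change -(mk n (Tm.sum _ _)) = _
    rw [mk_sum]
    congr 1
    refine Finset.sum_congr rfl fun i _ => ?_
    have : (-n + ((i : ℕ) : ℤ)).toNat = (-n).toNat + i := by omega
    rw [this]
    rfl

/-! ### Completeness from the identity decompositions -/

theorem neg_comp_mk {n : ℤ} {x y z : Word} (f : Tm x y) (g : Tm y z) :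
    mk n (Tm.comp (Tm.neg f) g) = -mk n (Tm.comp f g) :=
  DFunLike.congr_fun (map_neg compHom (mk n f)) (mk n g)

theorem comp_neg_mk {n : ℤ} {x y z : Word} (f : Tm x y) (g : Tm y z) :
    mk n (Tm.comp f (Tm.neg g)) = -mk n (Tm.comp f g) :=
  map_neg (compHom (mk n f)) (mk n g)

/-- In the double sum of `Rel.decomp_EF` the cup depends only on the outer index. Pulling it out
leaves the inner sum over j, which is the definition of `sigmaEF`. No sign condition on n is
required, so the relation remains available when the bubble sum is empty. -/
theorem total_EF (n : ℤ) :
    mk n (Tm.comp (Tm.neg swapEF) swapFE) +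
      ∑ s : Fin n.toNat, (mk n (sigmaEF n s)).comp (mk n (lambdaEF n s)) =
      mk n (Tm.id [Sgn.E, Sgn.F]) := by
  rw [sound Rel.decomp_EF, neg_comp_mk]
  change _ = -mk n (Tm.comp swapEF swapFE) + mk n (Tm.sum _ _)
  rw [mk_sum]
  congr 1
  refine Finset.sum_congr rfl fun s _ => ?_
  rw [sigmaEF, mk_sum, mk_sum, UStar.sum_comp]
  exact Finset.sum_congr rfl fun j _ => sound (Rel.assoc _ _ _)

theorem total_FE (n : ℤ) :
    mk n (Tm.comp (Tm.neg swapFE) swapEF) +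
      ∑ s : Fin (-n).toNat, (mk n (sigmaFE n s)).comp (mk n (lambdaFE n s)) =
      mk n (Tm.id [Sgn.F, Sgn.E]) := by
  rw [sound Rel.decomp_FE, neg_comp_mk]
  change _ = -mk n (Tm.comp swapFE swapEF) + mk n (Tm.sum _ _)
  rw [mk_sum]
  congr 1
  refine Finset.sum_congr rfl fun s _ => ?_
  rw [sigmaFE, mk_sum, mk_sum, UStar.sum_comp]
  exact Finset.sum_congr rfl fun j _ => sound (Rel.assoc _ _ _)

/-- For n ≥ 0 the decomposition of FE has no bubble terms: it states that the two sideways crossings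
compose to minus the identity. The sign sits on one factor here and on the other in `total_FE`,
which makes no difference by bilinearity. -/
theorem swapFE_neg_swapEF {n : ℤ} (hn : 0 ≤ n) :
    mk n (Tm.comp swapFE (Tm.neg swapEF)) = mk n (Tm.id [Sgn.F, Sgn.E]) := by
  have h : IsEmpty (Fin (-n).toNat) := by
    rw [Int.toNat_of_nonpos (by omega)]; infer_instance
  rw [← total_FE, Finset.univ_eq_empty, Finset.sum_empty, add_zero, neg_comp_mk, comp_neg_mk]

theorem swapEF_neg_swapFE {n : ℤ} (hn : n ≤ 0) :
    mk n (Tm.comp swapEF (Tm.neg swapFE)) = mk n (Tm.id [Sgn.E, Sgn.F]) := by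
  have h : IsEmpty (Fin n.toNat) := by
    rw [Int.toNat_of_nonpos (by omega)]; infer_instance
  rw [← total_EF, Finset.univ_eq_empty, Finset.sum_empty, add_zero, neg_comp_mk, comp_neg_mk]

/-! ## The decompositions -/

/-- The underlying 2-morphism of `U^*`, as an additive map. -/
def OneMor.valHom {a b : Wt} (x y : a ⟶ b) : (x ⟶ y) →+ UStar a.n x.word y.word :=
  (UStar.homog a.n (x.shift - y.shift) x.word y.word).subtype

theorem OneMor.valHom_injective {a b : Wt} (x y : a ⟶ b) :
    Function.Injective (OneMor.valHom x y) := Subtype.val_injective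

/-- The decomposition of `E F 1_n` for `n ≥ 0`. -/
def splitEF {n : ℤ} (hn : 0 ≤ n) :
    SplitData (EF n) (FE n) fun s : Fin n.toNat => oneSh n ((n.toNat : ℤ) - 1 - 2 * (s : ℕ)) where
  σ₀ := sigmaSwapEF n
  l₀ := lambdaSwapEF n
  σ := sigEF n
  l := lamEF n
  -- This field comes from the decomposition of the other word, FE, whereas `total` comes from that
  -- of EF.
  l₀_σ₀ := Subtype.ext (swapFE_neg_swapEF hn)
  l_σ s := Subtype.ext ((lambda_sigma_EF s.isLt).trans (if_pos rfl))
  l_σ_ne s t h := Subtype.ext ((lambda_sigma_EF s.isLt).trans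
    (if_neg fun h' => h (Fin.ext h'.symm)))
  total := by
    -- Degree-preserving maps form a subgroup of all 2-morphisms, so the identity may be checked
    -- after forgetting degrees.
    refine (OneMor.valHom_injective _ _) ?_
    rw [map_add, map_sum]
    exact total_EF n

/-- The decomposition of `F E 1_n` for `n ≤ 0`. -/
def splitFE {n : ℤ} (hn : n ≤ 0) :
    SplitData (FE n) (EF n)
      fun s : Fin (-n).toNat => oneSh n (((-n).toNat : ℤ) - 1 - 2 * (s : ℕ)) where
  σ₀ := sigmaSwapFE n
  l₀ := lambdaSwapFE n
  σ := sigFE n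
  l := lamFE n
  l₀_σ₀ := Subtype.ext (swapEF_neg_swapFE hn)
  l_σ s := Subtype.ext ((lambda_sigma_FE s.isLt).trans (if_pos rfl))
  l_σ_ne s t h := Subtype.ext ((lambda_sigma_FE s.isLt).trans
    (if_neg fun h' => h (Fin.ext h'.symm)))
  total := by
    refine (OneMor.valHom_injective _ _) ?_
    rw [map_add, map_sum]
    exact total_FE n

theorem idemEF_eq {n : ℤ} (hn : 0 ≤ n) : idemEF n = (splitEF hn).idem := by
  funext s
  cases s <;> rfl

theorem idemFE_eq {n : ℤ} (hn : n ≤ 0) : idemFE n = (splitFE hn).idem := by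
  funext s
  cases s <;> rfl

/-- The isomorphism `E F 1_n ≅ F E 1_n ⊕ (⊕_{[n]} 1_n)`. -/
noncomputable def isoEF {n : ℤ} (hn : 0 ≤ n) : objEF n ≅ objFE n ⊞ qSum n.toNat (objOne n) :=
  -- The embedding of a shifted unit and the shift of the embedded unit are definitionally the same
  -- one-term formal sum, so the target is literally `qSum`.
  ((splitEF hn).map (inc n n)).iso

/-- The isomorphism `F E 1_n ≅ E F 1_n ⊕ (⊕_{[-n]} 1_n)`. -/
noncomputable def isoFE {n : ℤ} (hn : n ≤ 0) : objFE n ≅ objEF n ⊞ qSum (-n).toNat (objOne n) :=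
  ((splitFE hn).map (inc n n)).iso

end CatSl2

theorem mainTheorem7 (n : ℤ) :
    (0 ≤ n →
      CompleteOrthogonalIdempotents (CatSl2.idemEF n) ∧
      (∃ φ : CatSl2.objEF n ≅ CatSl2.objFE n ⊞ CatSl2.qSum n.toNat (CatSl2.objOne n),
        φ.hom ≫ biprod.fst = (CatSl2.inc n n).map (CatSl2.sigmaSwapEF n) ∧
        biprod.inl ≫ φ.inv = (CatSl2.inc n n).map (CatSl2.lambdaSwapEF n) ∧
        ∀ s : Fin n.toNat,
          φ.hom ≫ biprod.snd ≫ CatSl2.qProj n.toNat (CatSl2.objOne n) s =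
            (CatSl2.inc n n).map (CatSl2.sigEF n s) ∧
          CatSl2.qIncl n.toNat (CatSl2.objOne n) s ≫ biprod.inr ≫ φ.inv =
            (CatSl2.inc n n).map (CatSl2.lamEF n s)) ∧
      CatSl2.K0.cls (CatSl2.objEF n) - CatSl2.K0.cls (CatSl2.objFE n) =
        CatSl2.qInt n.toNat • CatSl2.K0.cls (CatSl2.objOne n)) ∧
    (n ≤ 0 →
      CompleteOrthogonalIdempotents (CatSl2.idemFE n) ∧
      (∃ φ : CatSl2.objFE n ≅ CatSl2.objEF n ⊞ CatSl2.qSum (-n).toNat (CatSl2.objOne n),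
        φ.hom ≫ biprod.fst = (CatSl2.inc n n).map (CatSl2.sigmaSwapFE n) ∧
        biprod.inl ≫ φ.inv = (CatSl2.inc n n).map (CatSl2.lambdaSwapFE n) ∧
        ∀ s : Fin (-n).toNat,
          φ.hom ≫ biprod.snd ≫ CatSl2.qProj (-n).toNat (CatSl2.objOne n) s =
            (CatSl2.inc n n).map (CatSl2.sigFE n s) ∧
          CatSl2.qIncl (-n).toNat (CatSl2.objOne n) s ≫ biprod.inr ≫ φ.inv =
            (CatSl2.inc n n).map (CatSl2.lamFE n s)) ∧
      CatSl2.K0.cls (CatSl2.objFE n) - CatSl2.K0.cls (CatSl2.objEF n) =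
        CatSl2.qInt (-n).toNat • CatSl2.K0.cls (CatSl2.objOne n)) := by

  refine ⟨fun hn => ⟨?_, ⟨CatSl2.isoEF hn, ?_, ?_, fun s => ⟨?_, ?_⟩⟩, ?_⟩,
    fun hn => ⟨?_, ⟨CatSl2.isoFE hn, ?_, ?_, fun s => ⟨?_, ?_⟩⟩, ?_⟩⟩
  · rw [CatSl2.idemEF_eq hn]
    exact (CatSl2.splitEF hn).completeOrthogonalIdempotents
  · exact biprod.lift_fst _ _
  · exact biprod.inl_desc _ _
  · exact (Category.assoc _ _ _).symm.trans
      ((congrArg (· ≫ _) (biprod.lift_snd _ _)).trans (biproduct.lift_π _ _))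
  · exact (congrArg (_ ≫ ·) (biprod.inr_desc _ _)).trans (biproduct.ι_desc _ _)
  · exact CatSl2.K0.cls_sub_of_iso (CatSl2.isoEF hn)
  · rw [CatSl2.idemFE_eq hn]
    exact (CatSl2.splitFE hn).completeOrthogonalIdempotents
  · exact biprod.lift_fst _ _
  · exact biprod.inl_desc _ _
  · exact (Category.assoc _ _ _).symm.trans
      ((congrArg (· ≫ _) (biprod.lift_snd _ _)).trans (biproduct.lift_π _ _))
  · exact (congrArg (_ ≫ ·) (biprod.inr_desc _ _)).trans (biproduct.ι_desc _ _)
  · exact CatSl2.K0.cls_sub_of_iso (CatSl2.isoFE hn)
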